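/- Let $n \ge 0$, let $R$ be an arbitrary (possibly infinite) set of words in the free group on $x_1,\dots,x_n$, and let $H = \langle x_1,\dots,x_n \mid R\rangle$ be the finitely generated group so presented. Suppose that $H$ is left orderable (that is, $H$ admits a total order $\le$ such that $b \le c$ implies $ab \le ac$ for all $a,b,c \in H$) and that the presentation is reduced, meaning that each $x_i$ is nontrivial in $H$. Then the formal square root $$G = \langle y_1,\dots,y_n,x_1,\dots,x_n \mid R,\ x_1 = y_1^2,\dots,x_n = y_n^2\rangle$$ of this presentation is left orderable. -/

import Mathlib

/-- A group is left orderable if it admits a total order invariant under left multiplication. -/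
def LeftOrderable (G : Type*) [Group G] : Prop :=
  ∃ _ : LinearOrder G, ∀ a b c : G, b ≤ c → a * b ≤ a * c

/-- The presentation `⟨ι | R⟩` is reduced if every generator is nontrivial in the presented
group. -/
def IsReducedPresentation {ι : Type*} (R : Set (FreeGroup ι)) : Prop :=
  ∀ i : ι, (PresentedGroup.of i : PresentedGroup R) ≠ 1

/-- The relators of the formal square root of `⟨x_i | R⟩`. The generators are indexed by `ι ⊕ ι`:
`Sum.inl i` is the new generator `y_i` and `Sum.inr i` is the old generator `x_i`. The relators are
those of `R`, written in the `x_i`, and the words `x_i * (y_i ^ 2)⁻¹`. -/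
def formalSquareRootRels {ι : Type*} (R : Set (FreeGroup ι)) : Set (FreeGroup (ι ⊕ ι)) :=
  FreeGroup.map Sum.inr '' R ∪
    Set.range fun i : ι => FreeGroup.of (Sum.inr i) * (FreeGroup.of (Sum.inl i) ^ 2)⁻¹

/-- The formal square root `⟨y_i, x_i | R, x_i = y_i ^ 2⟩` of the presentation `⟨x_i | R⟩`. -/
abbrev FormalSquareRoot {ι : Type*} (R : Set (FreeGroup ι)) : Type _ :=
  PresentedGroup (formalSquareRootRels R)

/-! `H` is countable, so it embeds in the group `Q` of order automorphisms of `ℚ`, where every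
element has a square root (`OrderIso.exists_sq_eq`). Choose roots `s i` of the images of the `x_i`;
reducedness gives them infinite order. Sending `y_i` to `s i` extends the action of `H`, but perhaps
not faithfully.

A skew product repairs this. On `Q ×ₗ F`, with `F` free on `ι × Q`, let `H` move the first
coordinate only, while `y_i` also multiplies the second by a letter naming the current `s i`-orbit.
Its exponent alternates along the orbit, so `y_i ^ 2` still acts as `x_i`. A reduced word in `H` and
the `y_i` then writes a reduced word of `F`, which makes the action faithful
(`leftOrderable_of_embedding`). As `Q` and `F` are left orderable, it preserves a linear order, and
such a faithful action yields a left order. -/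

/-! ### Left orders from actions on linear orders. -/

/-- Elements are compared at the first `p i` where their images differ. Left multiplication applies
one increasing map to both images, so neither that place nor the direction changes. -/
theorem LeftOrderable.of_injective_of_surjective {G Ω I : Type*} [Group G] [LinearOrder Ω]
    [LinearOrder I] [WellFoundedLT I] (p : I → Ω) (hp : Function.Surjective p)
    (φ : G →* (Ω ≃o Ω)) (hφ : Function.Injective φ) : LeftOrderable G := by
  let e : G → Lex (I → Ω) := fun g => toLex fun i => φ g (p i)
  have he : Function.Injective e := by
    intro a b hab
    apply hφ
    ext x
    obtain ⟨i, rfl⟩ := hp x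
    exact congrFun (congrArg ofLex hab) i
  refine ⟨LinearOrder.lift' e he, fun a b c hbc => ?_⟩
  change e b ≤ e c at hbc
  change e (a * b) ≤ e (a * c)
  rcases hbc.lt_or_eq with h | h
  · obtain ⟨i, hlt, hi⟩ := h
    refine le_of_lt ⟨i, fun j hj => ?_, ?_⟩
    · have : φ b (p j) = φ c (p j) := hlt j hj
      change φ (a * b) (p j) = φ (a * c) (p j)
      simp only [map_mul, RelIso.mul_apply, this]
    · have : φ b (p i) < φ c (p i) := hi
      change φ (a * b) (p i) < φ (a * c) (p i)
      simpa only [map_mul, RelIso.mul_apply, OrderIso.lt_iff_lt] using this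
  · rw [he h]

/-- A group acting faithfully by order automorphisms on a linear order is left orderable. -/
theorem LeftOrderable.of_injective {G Ω : Type*} [Group G] [oΩ : LinearOrder Ω]
    (φ : G →* (Ω ≃o Ω)) (hφ : Function.Injective φ) : LeftOrderable G := by
  obtain ⟨o, ho⟩ := exists_wellFoundedLT Ω
  exact @LeftOrderable.of_injective_of_surjective G Ω Ω _ oΩ o ho id Function.surjective_id φ hφ

/-! ### Free groups, by a Magnus-type expansion. -/

namespace FreeGroup

variable {A : Type*}

open Classical in
/-- The operator `v ↦ X_a v` on noncommutative power series, in the quotient by `X_a ^ 2 = 0`. -/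
noncomputable def mulLetter (a : A) (v : List A → ℤ) : List A → ℤ
  | [] => 0
  | b :: t => if b = a ∧ t.head? ≠ some a then v t else 0

theorem mulLetter_cons_of_ne {a : A} {t : List A} (h : t.head? ≠ some a) (v : List A → ℤ) :
    mulLetter a v (a :: t) = v t := by
  simp [mulLetter, h]

theorem mulLetter_of_head_ne {a : A} {t : List A} (h : t.head? ≠ some a) (v : List A → ℤ) :
    mulLetter a v t = 0 := by
  cases t with
  | nil => rfl
  | cons b t => simp_all [mulLetter]

/-- The operator `v ↦ (1 + n X_a) v`. -/
noncomputable def shear (a : A) (n : ℤ) (v : List A → ℤ) : List A → ℤ :=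
  fun u => v u + n * mulLetter a v u

theorem shear_shear_neg (a : A) (n : ℤ) (v : List A → ℤ) : shear a n (shear a (-n) v) = v := by
  funext u
  cases u with
  | nil => simp [shear, mulLetter]
  | cons b t =>
    by_cases h : b = a ∧ t.head? ≠ some a
    · obtain ⟨rfl, ht⟩ := h
      simp only [shear, mulLetter_cons_of_ne ht, mulLetter_of_head_ne ht]
      ring
    · simp [shear, mulLetter, h]

/-- The action of a word on the constant series `1`, letters acting as `(1 + X_a) ^ (±1)`. -/
noncomputable def series : List (A × Bool) → List A → ℤ
  | [] => fun u => if u.length = 0 then 1 else 0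
  | x :: L => shear x.1 (cond x.2 1 (-1)) (series L)

/-- A run of `n` equal letters acts as `1 + n X_a`, so the top monomial of a reduced word takes one
`X` from each run. The sign condition ensures that lengthening the first run adds to the top
coefficient without cancellation. -/
theorem exists_leading_coeff (x : A × Bool) (L : List (A × Bool)) (hL : IsReduced (x :: L)) :
    ∃ t : List A, t.head? ≠ some x.1 ∧
      0 < cond x.2 1 (-1) * (series (x :: L) (x.1 :: t) * series (x :: L) t) ∧
      (∀ u, t.length + 1 < u.length → series (x :: L) u = 0) ∧
      ∀ u, t.length < u.length → u.head? ≠ some x.1 → series (x :: L) u = 0 := by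
  have of_head_ne : ∀ {a : A} {n : ℤ} {v : List A → ℤ} {u : List A}, u.head? ≠ some a →
      shear a n v u = v u := fun h => by simp [shear, mulLetter_of_head_ne h]
  have of_cons : ∀ {a : A} {n : ℤ} {v : List A → ℤ} {t : List A}, t.head? ≠ some a →
      shear a n v (a :: t) = v (a :: t) + n * v t := fun h => by
    simp [shear, mulLetter_cons_of_ne h]
  have vanish : ∀ {a : A} {n : ℤ} {v : List A → ℤ} {u : List A}, v u = 0 →
      (∀ t, u = a :: t → t.head? ≠ some a → v t = 0) → shear a n v u = 0 := by
    intro a n v u hu ht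
    cases u with
    | nil => simp [shear, mulLetter, hu]
    | cons b t =>
      by_cases h : b = a ∧ t.head? ≠ some a
      · obtain ⟨rfl, h⟩ := h
        rw [of_cons h, hu, ht t rfl h]
        simp
      · simp [shear, mulLetter, h, hu]
  induction L generalizing x with
  | nil =>
    refine ⟨[], by simp, ?_, ?_, ?_⟩
    · cases h : x.2 <;> simp [series, shear, mulLetter, h]
    · intro u hu
      refine vanish (by simp [series]; rintro rfl; simp at hu) ?_
      rintro t rfl -
      simp [series]
      rintro rfl
      simp at hu
    · intro u hu hx
      refine (of_head_ne hx).trans ?_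
      simp [series]
      rintro rfl
      simp at hu
  | cons y L ih =>
    rw [isReduced_cons_cons] at hL
    obtain ⟨t, ht, hpos, hvan, hvan'⟩ := ih y hL.2
    have hsq : cond x.2 (1 : ℤ) (-1) * cond x.2 1 (-1) = 1 := by cases x.2 <;> rfl
    have hs : series (x :: y :: L) = shear x.1 (cond x.2 1 (-1)) (series (y :: L)) := rfl
    rw [hs]
    set v := series (y :: L) with hv
    by_cases hxy : x.1 = y.1
    · obtain rfl : x = y := Prod.ext hxy (hL.1 hxy)
      refine ⟨t, ht, ?_, ?_, ?_⟩
      · rw [of_cons ht, of_head_ne ht]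
        have : 0 < v t * v t := mul_self_pos.2 fun h0 => by simp [h0] at hpos
        linear_combination hpos + this - hsq * (v t * v t)
      · intro u hu
        refine vanish (hvan u hu) ?_
        rintro s rfl hs
        exact hvan' s (by simpa using hu) hs
      · intro u hu hx
        rw [of_head_ne hx]
        exact hvan' u hu hx
    -- A new run begins: the old top monomial `y.1 :: t` plays the role of `t`.
    · have hne : (y.1 :: t).head? ≠ some x.1 := by simpa using fun h => hxy h.symm
      refine ⟨y.1 :: t, hne, ?_, ?_, ?_⟩
      · rw [of_cons hne, of_head_ne hne, hvan (x.1 :: y.1 :: t) (by simp)]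
        have : 0 < v (y.1 :: t) * v (y.1 :: t) :=
          mul_self_pos.2 fun h0 => by simp [h0] at hpos
        linear_combination this - hsq * (v (y.1 :: t) * v (y.1 :: t))
      · intro u hu
        simp only [List.length_cons] at hu
        refine vanish (hvan u (by omega)) ?_
        rintro s rfl -
        exact hvan s (by simpa using hu)
      · intro u hu hx
        rw [of_head_ne hx]
        exact hvan u hu

variable [LinearOrder (List A)] [WellFoundedLT (List A)]

/-- The operator `1 + n X_a` preserves the lexicographic order on coefficients. -/
noncomputable def shearIso (hlt : ∀ (a : A) t, t < a :: t) (a : A) (n : ℤ) :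
    Lex (List A → ℤ) ≃o Lex (List A → ℤ) :=
  StrictMono.orderIsoOfSurjective (fun v => toLex (shear a n (ofLex v)))
    (by
      rintro v w ⟨u, hu, hvw⟩
      -- The coefficient of `X_a v` at a word involves `v` only at its tail, which is strictly
      -- smaller by `hlt`.
      have key : ∀ t, t ≤ u → mulLetter a (ofLex v) t = mulLetter a (ofLex w) t := by
        intro t ht
        cases t with
        | nil => rfl
        | cons b t =>
          have : v t = w t := hu t ((hlt b t).trans_le ht)
          simp [mulLetter, this]
      refine ⟨u, fun j hj => ?_, ?_⟩
      · have h1 : v j = w j := hu j hj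
        simp [shear, key j hj.le, h1]
      · simpa [shear, key u le_rfl] using hvw)
    (fun v => ⟨toLex (shear a (-n) (ofLex v)), by
      simp [shear_shear_neg]⟩)

theorem shearIso_apply (hlt : ∀ (a : A) t, t < a :: t) (a : A) (n : ℤ) (v : Lex (List A → ℤ)) :
    shearIso hlt a n v = toLex (shear a n (ofLex v)) := rfl

theorem shearIso_inv (hlt : ∀ (a : A) t, t < a :: t) (a : A) :
    (shearIso hlt a 1)⁻¹ = shearIso hlt a (-1) := by
  rw [inv_eq_iff_mul_eq_one]
  refine RelIso.ext fun v => ?_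
  exact congrArg toLex (shear_shear_neg a 1 (ofLex v))

theorem lift_shearIso_mk (hlt : ∀ (a : A) t, t < a :: t) (L : List (A × Bool)) :
    lift (fun a => shearIso hlt a 1) (mk L) (toLex (series [])) = toLex (series L) := by
  rw [lift_mk]
  induction L with
  | nil => rfl
  | cons x L ih =>
    rw [List.map_cons, List.prod_cons, RelIso.mul_apply, ih]
    cases h : x.2 <;> simp [h, series, shearIso_inv, shearIso_apply]

end FreeGroup

/-- Free groups are left orderable. -/
theorem FreeGroup.leftOrderable (A : Type*) : LeftOrderable (FreeGroup A) := by
  have wf : WellFounded fun s t : List A => s.length < t.length :=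
    InvImage.wf List.length wellFounded_lt
  obtain ⟨_, hr, _⟩ : ∃ o : LinearOrder (List A), (∀ s t : List A, s.length < t.length → o.lt s t) ∧
      WellFoundedLT (List A) := by
    have : IsWellFounded (List A) fun s t => s.length < t.length := ⟨wf⟩
    exact ⟨IsWellFounded.wellOrderExtension fun s t : List A => s.length < t.length,
      fun s t h => Prod.Lex.left _ _ (IsWellFounded.rank_lt_of_rel h),
      ⟨(IsWellFounded.wellOrderExtension.isWellFounded_lt _).wf⟩⟩
  have hlt : ∀ (a : A) t, t < a :: t := fun a t => hr _ _ (by simp)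
  refine LeftOrderable.of_injective (lift fun a => shearIso hlt a 1) ?_
  rw [injective_iff_map_eq_one]
  intro w hw
  classical
  have hred : IsReduced w.toWord := isReduced_toWord
  have h := lift_shearIso_mk hlt w.toWord
  rw [mk_toWord, hw, RelIso.one_apply, toLex_inj] at h
  cases hL : w.toWord with
  | nil => exact toWord_eq_nil_iff.1 hL
  | cons x L =>
    rw [hL] at h hred
    obtain ⟨t, -, hpos, -⟩ := exists_leading_coeff x L hred
    -- The constant series `1` has coefficient zero at the nonempty word `x.1 :: t`.
    rw [← h] at hpos
    simp [series] at hpos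

/-! ### Square roots of order automorphisms. -/

namespace OrderIso

variable {Ω : Type*} [LinearOrder Ω]

/-- Two points are in the same orbital of `f` if each lies in the convex hull of the `f`-orbit of
the other. -/
def SameOrbital (f : Ω ≃o Ω) (z w : Ω) : Prop := ∃ m n : ℤ, (f ^ m) z ≤ w ∧ w ≤ (f ^ n) z

namespace SameOrbital

variable {f : Ω ≃o Ω} {z w u : Ω}

theorem zpow_add_apply (f : Ω ≃o Ω) (m n : ℤ) (z : Ω) : (f ^ (m + n)) z = (f ^ m) ((f ^ n) z) := by
  rw [zpow_add, RelIso.mul_apply]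

theorem refl (f : Ω ≃o Ω) (z : Ω) : SameOrbital f z z := ⟨0, 0, by simp, by simp⟩

theorem symm (h : SameOrbital f z w) : SameOrbital f w z := by
  obtain ⟨m, n, hm, hn⟩ := h
  refine ⟨-n, -m, ?_, ?_⟩
  · rw [← (f ^ n).le_iff_le, ← zpow_add_apply]
    simpa using hn
  · rw [← (f ^ m).le_iff_le, ← zpow_add_apply]
    simpa using hm

theorem trans (h : SameOrbital f z w) (h' : SameOrbital f w u) : SameOrbital f z u := by
  obtain ⟨m, n, hm, hn⟩ := h
  obtain ⟨m', n', hm', hn'⟩ := h'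
  refine ⟨m' + m, n' + n, ?_, ?_⟩
  · rw [zpow_add_apply]
    exact ((f ^ m').monotone hm).trans hm'
  · rw [zpow_add_apply]
    exact hn'.trans ((f ^ n').monotone hn)

theorem of_inv (h : SameOrbital f⁻¹ z w) : SameOrbital f z w := by
  obtain ⟨m, n, hm, hn⟩ := h
  exact ⟨-m, -n, by simpa using hm, by simpa using hn⟩

theorem inv (h : SameOrbital f z w) : SameOrbital f⁻¹ z w :=
  of_inv (by simpa using h)

theorem apply_right (h : SameOrbital f z w) : SameOrbital f z (f w) :=
  h.trans ⟨1, 1, by simp, by simp⟩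

theorem of_between {v : Ω} (h : SameOrbital f z w) (hwu : w ≤ u) (huv : u ≤ v)
    (h' : SameOrbital f z v) : SameOrbital f z u := by
  obtain ⟨m, -, hm, -⟩ := h
  obtain ⟨-, n, -, hn⟩ := h'
  exact ⟨m, n, hm.trans hwu, huv.trans hn⟩

/-- The equivalence relation whose classes are the orbitals of `f`. -/
def setoid (f : Ω ≃o Ω) : Setoid Ω := ⟨SameOrbital f, refl f, symm, trans⟩

end SameOrbital

open SameOrbital

/-- `s` restricts to a strictly increasing square root of `f` on the orbital of `p`. -/
def IsSqrtOnOrbital (f : Ω ≃o Ω) (p : Ω) (s : Ω → Ω) : Prop :=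
  ∀ z, SameOrbital f p z → SameOrbital f p (s z) ∧ s (s z) = f z ∧
    ∀ w, SameOrbital f p w → z < w → s z < s w

/-- Orbitals are convex and each root preserves its orbital, so the glued map is also increasing
between different orbitals. -/
theorem exists_sq_eq_of_orbital (f : Ω ≃o Ω) (h : ∀ p, ∃ s, IsSqrtOnOrbital f p s) :
    ∃ g : Ω ≃o Ω, g ^ 2 = f := by
  choose s hs using h
  let r : Ω → Ω := fun z => (Quotient.mk (setoid f) z).out
  have hr : ∀ z, SameOrbital f (r z) z := fun z => Quotient.mk_out (s := setoid f) z
  have hr' : ∀ {z w}, SameOrbital f z w → r z = r w := fun h =>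
    congrArg Quotient.out (Quotient.sound (s := setoid f) h)
  let g : Ω → Ω := fun z => s (r z) z
  have hg : ∀ z, SameOrbital f z (g z) := fun z => (hr z).symm.trans (hs _ z (hr z)).1
  have hgg : ∀ z, g (g z) = f z := fun z => by
    change s (r (g z)) (g z) = f z
    rw [← hr' (hg z)]
    exact (hs _ z (hr z)).2.1
  have hmono : StrictMono g := by
    intro z w hzw
    by_cases h : SameOrbital f z w
    · change s (r z) z < s (r w) w
      rw [← hr' h]
      exact (hs _ z (hr z)).2.2 w ((hr z).trans h) hzw
    · by_contra! hle
      rcases le_total w (g z) with h1 | h1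
      · exact h ((SameOrbital.refl f z).of_between hzw.le h1 (hg z))
      · exact h ((hg z).trans (((hg w).of_between hle h1 (SameOrbital.refl f w)).symm))
  refine ⟨hmono.orderIsoOfSurjective g fun z => ⟨g (f.symm z), by simp [hgg]⟩, ?_⟩
  refine RelIso.ext fun z => ?_
  rw [pow_two]
  exact hgg z

/-- On the orbital `s` commutes with `f`, hence `(f s)² = f² f⁻¹ = f`. -/
theorem IsSqrtOnOrbital.of_inv {f : Ω ≃o Ω} {p : Ω} {s : Ω → Ω} (h : IsSqrtOnOrbital f⁻¹ p s) :
    IsSqrtOnOrbital f p (f ∘ s) := by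
  have key : ∀ z, SameOrbital f p z → SameOrbital f p (s z) ∧ f (s (s z)) = z ∧
      ∀ w, SameOrbital f p w → z < w → s z < s w := fun z hz => by
    obtain ⟨h1, h2, h3⟩ := h z hz.inv
    exact ⟨h1.of_inv, by rw [h2]; exact f.apply_symm_apply z, fun w hw => h3 w hw.inv⟩
  have comm : ∀ z, SameOrbital f p z → s (f z) = f (s z) := fun z hz => by
    obtain ⟨h1, h2, -⟩ := key _ hz.apply_right
    obtain ⟨h3, h4, -⟩ := key _ h1
    rw [← h4, f.injective.eq_iff.1 (h2 : f (s (s (f z))) = f z)]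
  intro z hz
  obtain ⟨h1, h2, h3⟩ := key z hz
  refine ⟨h1.apply_right, ?_, fun w hw hzw => f.strictMono (h3 w hw hzw)⟩
  simp only [Function.comp_apply, comm _ h1, h2]

theorem strictMono_zpow_apply {f : Ω ≃o Ω} {p : Ω} (hp : p < f p) :
    StrictMono fun k : ℤ => (f ^ k) p := by
  refine strictMono_int_of_lt_succ fun k => ?_
  rw [zpow_add_apply, zpow_one]
  exact (f ^ k).strictMono hp

theorem exists_zpow_apply_eq {f : Ω ≃o Ω} {p : Ω} (hp : p < f p) {z : Ω} (hz : SameOrbital f p z) :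
    ∃ k : ℤ, ∃ a ∈ Set.Ico p (f p), (f ^ k) a = z := by
  obtain ⟨m, n, hm, hn⟩ := hz
  obtain ⟨k, hk, hmax⟩ := Int.exists_greatest_of_bdd (P := fun k => (f ^ k) p ≤ z)
    ⟨n, fun k hk => (strictMono_zpow_apply hp).le_iff_le.1 (hk.trans hn)⟩ ⟨m, hm⟩
  have hkz : (f ^ k) ((f ^ (-k)) z) = z := by rw [← zpow_add_apply]; simp
  refine ⟨k, (f ^ (-k)) z, ⟨?_, ?_⟩, hkz⟩
  · rwa [← (f ^ k).le_iff_le, hkz]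
  · rw [← (f ^ k).lt_iff_lt, hkz]
    by_contra! hle
    have := hmax (k + 1) (by rwa [zpow_add_apply, zpow_one])
    omega

theorem zpow_apply_lt_zpow_apply {f : Ω ≃o Ω} {q a b : Ω} (ha : a < f q)
    (hb : q ≤ b) (hq : q < f q) {k l : ℤ} (hkl : k < l) : (f ^ k) a < (f ^ l) b :=
  calc (f ^ k) a < (f ^ k) (f q) := (f ^ k).strictMono ha
    _ = (f ^ (k + 1)) q := by rw [zpow_add_apply, zpow_one]
    _ ≤ (f ^ l) q := (strictMono_zpow_apply hq).monotone (by omega)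
    _ ≤ (f ^ l) b := (f ^ l).monotone hb

theorem exists_isSqrtOnOrbital_of_lt {f : ℚ ≃o ℚ} {p : ℚ} (hp : p < f p) :
    ∃ s, IsSqrtOnOrbital f p s := by
  obtain ⟨d, hd⟩ : ∃ d, p + d + d = f p := ⟨(f p - p) / 2, by ring⟩
  have hd0 : 0 < d := by linarith
  have hq : p + d < f (p + d) := by
    have := f.strictMono (show p < p + d by linarith)
    linarith
  have hmem : ∀ {k : ℤ} {a : ℚ}, a ∈ Set.Ico p (f p) → SameOrbital f p ((f ^ k) a) :=
    fun {k a} ha => ⟨k, k + 1, (f ^ k).monotone ha.1, by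
      rw [zpow_add_apply, zpow_one]
      exact (f ^ k).monotone ha.2.le⟩
  have huniq : ∀ {k l : ℤ} {a b : ℚ}, a ∈ Set.Ico p (f p) → b ∈ Set.Ico p (f p) →
      (f ^ k) a ≤ (f ^ l) b → k < l ∨ k = l ∧ a ≤ b := fun {k l a b} ha hb h => by
    rcases lt_trichotomy k l with hkl | rfl | hkl
    · exact Or.inl hkl
    · exact Or.inr ⟨rfl, (f ^ k).le_iff_le.1 h⟩
    · exact absurd h (zpow_apply_lt_zpow_apply hb.2 ha.1 hp hkl).not_ge
  -- On the fundamental domain `[p, f p)` with midpoint `p + d`, the first half is shifted onto the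
  -- second, and the second is shifted back and moved by `f`. Two steps make `f`; `s` extends `s₀`
  -- so as to commute with `f`.
  let s₀ : ℚ → ℚ := fun a => if a < p + d then a + d else f (a - d)
  choose! k a ha hka using fun z => exists_zpow_apply_eq hp (z := z)
  let s : ℚ → ℚ := fun z => (f ^ k z) (s₀ (a z))
  have hs : ∀ (l : ℤ) b, b ∈ Set.Ico p (f p) → s ((f ^ l) b) = (f ^ l) (s₀ b) := by
    intro l b hb
    have h1 := huniq (ha _ (hmem hb)) hb (hka _ (hmem (k := l) hb)).le
    have h2 := huniq hb (ha _ (hmem hb)) (hka _ (hmem (k := l) hb)).ge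
    have hk : k ((f ^ l) b) = l := by omega
    have hab : a ((f ^ l) b) = b := le_antisymm (h1.resolve_left (by omega)).2
      (h2.resolve_left (by omega)).2
    simp only [s, hk, hab]
  have hrange : ∀ b ∈ Set.Ico p (f p), s₀ b ∈ Set.Ico (p + d) (f (p + d)) := by
    rintro b ⟨hb1, hb2⟩
    simp only [s₀]
    split_ifs with h
    · have := f.strictMono (show p < p + d by linarith)
      exact ⟨by linarith, by linarith⟩
    · have h1 := f.monotone (show p ≤ b - d by linarith)
      have h2 := f.strictMono (show b - d < p + d by linarith)
      exact ⟨by linarith, h2⟩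
  have hmono : ∀ b ∈ Set.Ico p (f p), ∀ c ∈ Set.Ico p (f p), b < c → s₀ b < s₀ c := by
    rintro b ⟨hb1, hb2⟩ c ⟨hc1, hc2⟩ hbc
    simp only [s₀]
    split_ifs with h h' h'
    · linarith
    · have := f.monotone (show p ≤ c - d by linarith)
      linarith
    · linarith
    · exact f.strictMono (by linarith)
  refine ⟨s, fun z hz => ?_⟩
  obtain ⟨l, b, hb, rfl⟩ := exists_zpow_apply_eq hp hz
  refine ⟨?_, ?_, fun w hw hzw => ?_⟩
  · rw [hs l b hb]
    have h := hrange b hb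
    refine SameOrbital.of_between (w := (f ^ l) p) (v := (f ^ (l + 2)) p) (hmem ⟨le_rfl, hp⟩) ?_ ?_
      (hmem ⟨le_rfl, hp⟩)
    · exact (f ^ l).monotone (by linarith [h.1])
    · rw [zpow_add_apply]
      refine (f ^ l).monotone (h.2.le.trans ?_)
      change f (p + d) ≤ f (f p)
      exact f.monotone (by linarith)
  · rw [hs l b hb]
    by_cases h : b < p + d
    · have : s₀ b = b + d := if_pos h
      rw [this, hs l _ ⟨by linarith [hb.1], by linarith⟩]
      have : s₀ (b + d) = f b := by
        simp only [s₀]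
        rw [if_neg (by linarith [hb.1]), add_sub_cancel_right]
      rw [this, ← RelIso.mul_apply, ← RelIso.mul_apply, mul_zpow_self, mul_self_zpow]
    · have : s₀ b = f (b - d) := if_neg h
      have h' : (f ^ l) (f (b - d)) = (f ^ (l + 1)) (b - d) := by rw [zpow_add_apply, zpow_one]
      rw [this, h', hs _ _ ⟨by linarith, by linarith [hb.2]⟩]
      have : s₀ (b - d) = b := by
        simp only [s₀]
        rw [if_pos (by linarith [hb.2]), sub_add_cancel]
      rw [this, ← RelIso.mul_apply, mul_self_zpow]
  · obtain ⟨m, c, hc, rfl⟩ := exists_zpow_apply_eq hp hw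
    rw [hs l b hb, hs m c hc]
    rcases huniq hb hc hzw.le with h | ⟨rfl, h⟩
    · exact zpow_apply_lt_zpow_apply (hrange b hb).2 (hrange c hc).1 hq h
    · exact (f ^ l).strictMono (hmono b hb c hc ((f ^ l).lt_iff_lt.1 hzw))

/-- Every order automorphism of `ℚ` has a square root. -/
theorem exists_sq_eq (f : ℚ ≃o ℚ) : ∃ g : ℚ ≃o ℚ, g ^ 2 = f := by
  refine exists_sq_eq_of_orbital f fun p => ?_
  rcases lt_trichotomy (f p) p with hp | hp | hp
  · have : p < f⁻¹ p := by
      rw [← f.lt_iff_lt]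
      exact hp.trans_eq (f.apply_symm_apply p).symm
    obtain ⟨s, hs⟩ := exists_isSqrtOnOrbital_of_lt this
    exact ⟨_, hs.of_inv⟩
  · have hfix : ∀ k : ℤ, (f ^ k) p = p := fun k =>
      (MulAction.mem_stabilizer_iff (G := ℚ ≃o ℚ)).1
        (zpow_mem (K := MulAction.stabilizer (ℚ ≃o ℚ) p) hp k)
    have hclass : ∀ z, SameOrbital f p z → z = p := by
      rintro z ⟨m, n, hm, hn⟩
      rw [hfix] at hm hn
      exact le_antisymm hn hm
    refine ⟨id, fun z hz => ⟨hz, ?_, fun w _ h => h⟩⟩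
    rw [hclass z hz]
    exact hp.symm
  · exact exists_isSqrtOnOrbital_of_lt hp

end OrderIso

/-! ### Actions on lexicographic products. -/

/-- Left multiplication in a left ordered group, acting by order automorphisms. -/
def LeftOrderable.leftMul {F : Type*} [Group F] [LinearOrder F]
    (h : ∀ a b c : F, b ≤ c → a * b ≤ a * c) : F →* (F ≃o F) where
  toFun a :=
    { Equiv.mulLeft a with
      map_rel_iff' := fun {b c} => ⟨fun hbc => by simpa using h a⁻¹ _ _ hbc, h a b c⟩ }
  map_one' := RelIso.ext one_mul
  map_mul' a b := RelIso.ext (mul_assoc a b)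

theorem LeftOrderable.leftMul_apply {F : Type*} [Group F] [LinearOrder F]
    (h : ∀ a b c : F, b ≤ c → a * b ≤ a * c) (a b : F) : leftMul h a b = a * b := rfl

/-- The order automorphism `(a, b) ↦ (e a, c a b)` of a lexicographic product. -/
noncomputable def OrderIso.lexSkew {A B : Type*} [LinearOrder A] [LinearOrder B] (e : A ≃o A)
    (c : A → (B ≃o B)) : A ×ₗ B ≃o A ×ₗ B :=
  StrictMono.orderIsoOfSurjective
    (fun x => toLex (e (ofLex x).1, c (ofLex x).1 (ofLex x).2))
    (fun x y hxy => by
      rw [Prod.Lex.lt_iff] at hxy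
      rw [Prod.Lex.toLex_lt_toLex]
      rcases hxy with h | ⟨h, h'⟩
      · exact Or.inl (e.strictMono h)
      · exact Or.inr ⟨congrArg e h, by simpa [h] using h'⟩)
    (fun y => ⟨toLex (e.symm (ofLex y).1, (c (e.symm (ofLex y).1)).symm (ofLex y).2), by simp⟩)

theorem OrderIso.lexSkew_apply {A B : Type*} [LinearOrder A] [LinearOrder B] (e : A ≃o A)
    (c : A → (B ≃o B)) (a : A) (b : B) :
    lexSkew e c (toLex (a, b)) = toLex (e a, c a b) := rfl

/-- The action of order automorphisms of `A` on the first coordinate of `A ×ₗ B`. -/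
noncomputable def OrderIso.lexSkewHom (A B : Type*) [LinearOrder A] [LinearOrder B] :
    (A ≃o A) →* (A ×ₗ B ≃o A ×ₗ B) where
  toFun e := lexSkew e fun _ => 1
  map_one' := RelIso.ext fun _ => rfl
  map_mul' _ _ := RelIso.ext fun _ => rfl

/-- A countable left orderable group acts faithfully on `ℚ` by order automorphisms. -/
theorem LeftOrderable.exists_injective_rat {H : Type*} [Group H] [Countable H]
    (hH : LeftOrderable H) : ∃ ψ : H →* (ℚ ≃o ℚ), Function.Injective ψ := by
  obtain ⟨_, h⟩ := hH
  have : Countable (H ×ₗ ℚ) := inferInstanceAs (Countable (H × ℚ))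
  have : Nonempty (H ×ₗ ℚ) := ⟨toLex (1, 0)⟩
  -- Cantor's theorem: the factor `ℚ` makes the product dense and without endpoints, whatever the
  -- order on `H`.
  obtain ⟨θ⟩ := Order.iso_of_countable_dense (H ×ₗ ℚ) ℚ
  let conj : (H ×ₗ ℚ ≃o H ×ₗ ℚ) →* (ℚ ≃o ℚ) :=
    { toFun := fun e => (θ.symm.trans e).trans θ
      map_one' := RelIso.ext fun x => θ.apply_symm_apply x
      map_mul' := fun e e' => RelIso.ext fun x => by simp [RelIso.mul_apply] }
  refine ⟨conj.comp ((OrderIso.lexSkewHom H ℚ).comp (leftMul h)), fun a b hab => ?_⟩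
  have h1 := DFunLike.congr_fun hab (θ (toLex (1, 0)))
  have h2 : θ (toLex (a * 1, 0)) = θ (toLex (b * 1, 0)) := by
    simpa [conj, OrderIso.lexSkewHom, OrderIso.lexSkew_apply, leftMul_apply] using h1
  simpa using h2

/-- A moved point has a strictly monotone orbit. -/
theorem OrderIso.zpow_eq_one_iff {Ω : Type*} [LinearOrder Ω] {s : Ω ≃o Ω} (hs : s ≠ 1) (k : ℤ) :
    s ^ k = 1 ↔ k = 0 := by
  refine ⟨fun hk => ?_, fun hk => by rw [hk, zpow_zero]⟩
  have key : ∀ (t : Ω ≃o Ω) p, p < t p → t ^ k = 1 → k = 0 := fun t p hp h =>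
    (strictMono_zpow_apply hp).injective (by simp [h])
  obtain ⟨p, hp⟩ : ∃ p, s p ≠ p := by
    by_contra! h
    exact hs (RelIso.ext h)
  rcases hp.lt_or_gt with hp | hp
  · refine key s⁻¹ p ?_ (by rw [inv_zpow, hk, inv_one])
    rw [← s.lt_iff_lt]
    exact hp.trans_eq (s.apply_symm_apply p).symm
  · exact key s p hp hk

/-- The orbits of left multiplication by an element `s` of infinite order can be labelled, and
their points coloured alternately. -/
theorem exists_orbit_label_and_parity {Q : Type*} [Group Q] (s : Q)
    (hs : ∀ k : ℤ, s ^ k = 1 ↔ k = 0) :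
    ∃ (cls : Q → Q) (sgn : Q → Bool), (∀ q, cls (s * q) = cls q) ∧ (∀ q, sgn (s * q) = !sgn q) ∧
      ∀ q q', cls q = cls q' → ∃ k : ℤ, q = s ^ k * q' ∧ (sgn q ≠ sgn q' → Odd k) := by
  let S := QuotientGroup.rightRel (Subgroup.zpowers s)
  let cls : Q → Q := fun q => (Quotient.mk S q).out
  have hcls : ∀ q, ∃ k : ℤ, q = s ^ k * cls q := fun q => by
    have h : S (cls q) q := Quotient.mk_out q
    rw [QuotientGroup.rightRel_apply] at h
    obtain ⟨k, hk⟩ := h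
    exact ⟨k, by simp only at hk; rw [hk, inv_mul_cancel_right]⟩
  choose k hk using hcls
  have hcls_mul : ∀ q, cls (s * q) = cls q := fun q => by
    refine congrArg Quotient.out (Quotient.sound (s := S) ?_)
    change S _ _
    rw [QuotientGroup.rightRel_apply]
    exact ⟨-1, by simp⟩
  -- Infinite order makes the exponent `k q` unique, so its parity alternates along the orbit.
  have hk_mul : ∀ q, k (s * q) = k q + 1 := fun q => by
    have h := hk (s * q)
    rw [hcls_mul] at h
    have h' : s ^ (k (s * q)) = s ^ (k q + 1) := by
      apply mul_right_cancel (b := cls q)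
      rw [← h, add_comm, zpow_add, zpow_one, mul_assoc, ← hk q]
    rw [← sub_eq_zero, ← hs, zpow_sub, h', mul_inv_cancel]
  refine ⟨cls, fun q => decide (Even (k q)), hcls_mul, fun q => ?_, fun q q' h => ?_⟩
  · simp only [hk_mul, Int.even_add_one, decide_not]
  · refine ⟨k q - k q', ?_, fun hne => ?_⟩
    · have h' : (s ^ k q')⁻¹ * q' = cls q' := inv_mul_eq_of_eq_mul (hk q')
      rw [zpow_sub, mul_assoc, h', ← h]
      exact hk q
    · rw [← Int.not_even_iff_odd, Int.even_sub]
      simpa using hne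

/-! ### Reduced words in the formal square root. -/

namespace FormalSquareRoot

variable {ι H G : Type*} [Group H] [Group G]

/-- The element `h₁ y_{i₁} h₂ y_{i₂} ⋯ h_m y_{i_m} h₀` given by the list of the pairs
`(i_j, h_j)`. -/
def evalWord (φ : H →* G) (y : ι → G) (h₀ : H) : List (ι × H) → G
  | [] => φ h₀
  | (i, h) :: L => φ h * y i * evalWord φ y h₀ L

/-- No subword `y_i h y_i` has `h` in the cyclic subgroup generated by `x_i`. -/
def IsReducedWord (x : ι → H) (L : List (ι × H)) : Prop :=
  L.IsChain fun a b => a.1 = b.1 → b.2 ∉ Subgroup.zpowers (x a.1)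

/-- The elements represented by reduced words. -/
def HasReducedWord (x : ι → H) (φ : H →* G) (y : ι → G) (g : G) : Prop :=
  ∃ h₀ L, IsReducedWord x L ∧ evalWord φ y h₀ L = g

variable {x : ι → H} {φ : H →* G} {y : ι → G}

theorem HasReducedWord.base_mul {g : G} (hg : HasReducedWord x φ y g) (h : H) :
    HasReducedWord x φ y (φ h * g) := by
  obtain ⟨h₀, L, hL, rfl⟩ := hg
  cases L with
  | nil => exact ⟨h * h₀, [], hL, map_mul φ h h₀⟩
  | cons a L =>
    refine ⟨h₀, (a.1, h * a.2) :: L, ?_, by simp [evalWord, mul_assoc]⟩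
    cases L with
    | nil => exact List.isChain_singleton _
    | cons b L => exact List.isChain_cons_cons.2 (List.isChain_cons_cons.1 hL)

theorem HasReducedWord.root_mul (hy : ∀ i, y i ^ 2 = φ (x i)) {g : G}
    (hg : HasReducedWord x φ y g) (i : ι) : HasReducedWord x φ y (y i * g) := by
  obtain ⟨h₀, L, hL, rfl⟩ := hg
  cases L with
  | nil => exact ⟨h₀, [(i, 1)], List.isChain_singleton _, by simp [evalWord]⟩
  | cons a L =>
    by_cases h : i = a.1 ∧ a.2 ∈ Subgroup.zpowers (x i)
    -- Here `y_i x_i ^ k y_i = x_i ^ (k + 1)` is absorbed into the base group.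
    · obtain ⟨rfl, k, hk⟩ := h
      have hL' : HasReducedWord x φ y (evalWord φ y h₀ L) := ⟨h₀, L, hL.tail, rfl⟩
      convert hL'.base_mul (x a.1 ^ (k + 1)) using 1
      simp only at hk
      rw [evalWord, ← hk, map_zpow, map_zpow, ← hy, ← mul_assoc, ← mul_assoc, ← zpow_natCast,
        ← zpow_mul, ← zpow_mul, ← zpow_one_add, ← zpow_add_one]
      congr 2
      push_cast
      ring
    · exact ⟨h₀, (i, 1) :: a :: L, List.isChain_cons_cons.2 ⟨fun h1 h2 => h ⟨h1, h2⟩, hL⟩,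
        by simp [evalWord]⟩

/-- The homomorphism from the presented group to the formal square root of the presentation. -/
def base (R : Set (FreeGroup ι)) : PresentedGroup R →* FormalSquareRoot R :=
  PresentedGroup.map (FreeGroup.map Sum.inr) fun r hr => Or.inl ⟨r, hr, rfl⟩

end FormalSquareRoot

namespace FormalSquareRoot

variable {ι : Type*} {R : Set (FreeGroup ι)}

theorem root_sq (i : ι) :
    (PresentedGroup.of (Sum.inl i) : FormalSquareRoot R) ^ 2 = base R (PresentedGroup.of i) :=
  (PresentedGroup.mk_eq_mk_of_mul_inv_mem (Or.inr ⟨i, rfl⟩)).symm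

theorem hasReducedWord (g : FormalSquareRoot R) :
    HasReducedWord PresentedGroup.of (base R) (fun i => PresentedGroup.of (Sum.inl i)) g := by
  let P : FormalSquareRoot R → Prop :=
    HasReducedWord PresentedGroup.of (base R) fun i => PresentedGroup.of (Sum.inl i)
  let S : Submonoid (FormalSquareRoot R) :=
    { carrier := {g | ∀ w, P w → P (g * w)}
      one_mem' := fun w hw => by rwa [one_mul]
      mul_mem' := fun {a b} ha hb w hw => by
        rw [mul_assoc]
        exact ha _ (hb _ hw) }
  have hbase : ∀ h, base R h ∈ S := fun h w hw => hw.base_mul h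
  have hroot : ∀ i, PresentedGroup.of (Sum.inl i) ∈ S := fun i w hw => hw.root_mul root_sq i
  have hmem : ∀ g, g ∈ S := by
    intro g
    induction g using PresentedGroup.induction_on with | _ w
    induction w using FreeGroup.induction_on with
    | C1 => exact S.one_mem
    | of a =>
      rcases a with i | i
      · exact hroot i
      · exact hbase (PresentedGroup.of i)
    | inv_of a _ =>
      rcases a with i | i
      -- `y_i⁻¹ = x_i⁻¹ y_i`, so a submonoid suffices.
      · have h : (PresentedGroup.of (Sum.inl i) : FormalSquareRoot R)⁻¹ =
            base R (PresentedGroup.of i)⁻¹ * PresentedGroup.of (Sum.inl i) := by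
          rw [map_inv, ← root_sq, pow_two, mul_inv_rev, inv_mul_cancel_right]
        change (PresentedGroup.of (Sum.inl i) : FormalSquareRoot R)⁻¹ ∈ S
        rw [h]
        exact S.mul_mem (hbase _) (hroot i)
      · exact hbase (PresentedGroup.of i)⁻¹
    | mul a b ha hb => exact S.mul_mem ha hb
  have := hmem g 1 ⟨1, [], List.isChain_nil, map_one _⟩
  rwa [mul_one] at this

theorem exists_hom {K : Type*} [Group K] (X : PresentedGroup R →* K) (Y : ι → K)
    (hY : ∀ i, Y i ^ 2 = X (PresentedGroup.of i)) :
    ∃ Θ : FormalSquareRoot R →* K, (∀ h, Θ (base R h) = X h) ∧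
      ∀ i, Θ (PresentedGroup.of (Sum.inl i)) = Y i := by
  let f : ι ⊕ ι → K := Sum.elim Y fun i => X (PresentedGroup.of i)
  have hf : (FreeGroup.lift f).comp (FreeGroup.map Sum.inr) = X.comp (PresentedGroup.mk R) :=
    FreeGroup.ext_hom _ _ fun i => by simp [f, PresentedGroup.of]
  have hrel : ∀ r ∈ formalSquareRootRels R, FreeGroup.lift f r = 1 := by
    rintro _ (⟨r, hr, rfl⟩ | ⟨i, rfl⟩)
    · have h := DFunLike.congr_fun hf r
      simp only [MonoidHom.comp_apply] at h
      rw [h, PresentedGroup.one_of_mem hr, map_one]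
    · simp [f, hY]
  refine ⟨PresentedGroup.toGroup hrel, fun h => ?_, fun i => PresentedGroup.toGroup.of hrel⟩
  exact DFunLike.congr_fun (f := (PresentedGroup.toGroup hrel).comp (base R)) (g := X)
    (PresentedGroup.ext fun i => PresentedGroup.toGroup.of hrel) h

/-! ### The faithful skew action. -/

/-- If the presented group embeds into a left orderable group in which every generator has a square
root of infinite order, then the formal square root is left orderable. -/
theorem leftOrderable_of_embedding {Q : Type*} [Group Q] (hQ : LeftOrderable Q)
    (ψ : PresentedGroup R →* Q) (hψ : Function.Injective ψ) (s : ι → Q)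
    (hs : ∀ i, s i ^ 2 = ψ (PresentedGroup.of i)) (hinf : ∀ i (k : ℤ), s i ^ k = 1 ↔ k = 0) :
    LeftOrderable (FormalSquareRoot R) := by
  obtain ⟨_, hQ⟩ := hQ
  obtain ⟨_, hF⟩ := FreeGroup.leftOrderable (ι × Q)
  choose cls sgn hcls hsgn horb using fun i => exists_orbit_label_and_parity (s i) (hinf i)
  let letter : ι → Q → (ι × Q) × Bool := fun i q => ((i, cls i q), sgn i q)
  let c : ι → Q → FreeGroup (ι × Q) := fun i q => FreeGroup.mk [letter i q]
  have hc : ∀ i q, c i (s i * q) * c i q = 1 := fun i q => by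
    have h : c i (s i * q) = (c i q)⁻¹ := by
      simp [c, letter, hcls, hsgn, FreeGroup.inv_mk, FreeGroup.invRev]
    rw [h, inv_mul_cancel]
  let X := (OrderIso.lexSkewHom Q (FreeGroup (ι × Q))).comp
    ((LeftOrderable.leftMul hQ).comp ψ)
  let Y : ι → (Q ×ₗ FreeGroup (ι × Q) ≃o Q ×ₗ FreeGroup (ι × Q)) := fun i =>
    OrderIso.lexSkew (LeftOrderable.leftMul hQ (s i)) fun q => LeftOrderable.leftMul hF (c i q)
  have hX : ∀ h q f, X h (toLex (q, f)) = toLex (ψ h * q, f) := fun h q f => rfl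
  have hY : ∀ i q f, Y i (toLex (q, f)) = toLex (s i * q, c i q * f) := fun i q f => rfl
  obtain ⟨Θ, hΘX, hΘY⟩ := exists_hom X Y fun i => by
    refine RelIso.ext fun z => ?_
    obtain ⟨⟨q, f⟩, rfl⟩ := toLex.surjective z
    rw [pow_two, RelIso.mul_apply, hY, hY, hX, ← mul_assoc, ← mul_assoc, hc, one_mul, ← hs, pow_two]
  -- The first coordinate reached from `(1, 1)`; `letters` records the word written in the second.
  let pos : PresentedGroup R → List (ι × PresentedGroup R) → Q := fun h₀ L =>
    L.foldr (fun a q => ψ a.2 * (s a.1 * q)) (ψ h₀)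
  let letters : PresentedGroup R → List (ι × PresentedGroup R) → List ((ι × Q) × Bool) :=
    fun h₀ L => L.rec [] fun a L w => letter a.1 (pos h₀ L) :: w
  have heval : ∀ h₀ L, Θ (evalWord (base R) (fun i => PresentedGroup.of (Sum.inl i)) h₀ L)
      (toLex (1, 1)) = toLex (pos h₀ L, FreeGroup.mk (letters h₀ L)) := by
    intro h₀ L
    induction L with
    | nil =>
      rw [evalWord, hΘX, hX, mul_one]
      rfl
    | cons a L ih =>
      rw [evalWord, map_mul, map_mul, RelIso.mul_apply, RelIso.mul_apply, ih, hΘX, hΘY, hY, hX]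
      simp only [c, FreeGroup.mul_mk]
      rfl
  have hred : ∀ h₀ L, IsReducedWord PresentedGroup.of L → FreeGroup.IsReduced (letters h₀ L) := by
    intro h₀ L hL
    induction L with
    | nil => exact FreeGroup.IsReduced.nil
    | cons a L ih =>
      cases L with
      | nil => exact FreeGroup.IsReduced.singleton
      | cons b L =>
        have hab := List.isChain_cons_cons.1 hL
        refine FreeGroup.isReduced_cons_cons.2 ⟨fun h => ?_, ih hab.2⟩
        obtain ⟨i, g⟩ := a
        obtain ⟨j, h'⟩ := b
        obtain ⟨rfl, hq⟩ : i = j ∧ cls i (pos h₀ ((j, h') :: L)) = cls j (pos h₀ L) :=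
          Prod.ext_iff.1 h
        -- If adjacent letters cancelled, the displacement along the orbit would be odd, `k = 2m +
        -- 1`. Removing the step made by `y_i` leaves `ψ h' = s i ^ (2m) = ψ (x_i ^ m)`, which
        -- reducedness of the word forbids.
        obtain ⟨k, hk, hodd⟩ := horb i _ _ hq
        by_contra hne
        obtain ⟨m, rfl⟩ := hodd hne
        refine hab.1 rfl ⟨m, hψ ?_⟩
        have h1 : ψ h' * (s i * pos h₀ L) = s i ^ (2 * m + 1) * pos h₀ L := hk
        rw [← mul_assoc, mul_left_inj, zpow_add, zpow_one, mul_left_inj, zpow_mul] at h1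
        simp only [map_zpow, ← hs, h1]
        norm_cast
  refine LeftOrderable.of_injective Θ ((injective_iff_map_eq_one _).2 fun g hg => ?_)
  obtain ⟨h₀, L, hL, rfl⟩ := hasReducedWord g
  have h := heval h₀ L
  rw [hg, RelIso.one_apply, toLex_inj, Prod.mk.injEq] at h
  have hnil : letters h₀ L = [] := by
    classical
    rw [← (hred h₀ L hL).reduce_eq, ← FreeGroup.toWord_mk, ← h.2, FreeGroup.toWord_one]
  cases L with
  | nil =>
    have h0 : h₀ = 1 := hψ (h.1.symm.trans (map_one ψ).symm)
    rw [h0, evalWord, map_one]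
  | cons a L => exact absurd hnil (List.cons_ne_nil _ _)

end FormalSquareRoot

theorem theorem4p3 (n : ℕ) (R : Set (FreeGroup (Fin n)))
    (hH : LeftOrderable (PresentedGroup R)) (hred : IsReducedPresentation R) :
    LeftOrderable (FormalSquareRoot R) := by
  have : Countable (PresentedGroup R) := (PresentedGroup.mk_surjective R).countable
  obtain ⟨ψ, hψ⟩ := hH.exists_injective_rat
  choose s hs using fun i => OrderIso.exists_sq_eq (ψ (PresentedGroup.of i))
  refine FormalSquareRoot.leftOrderable_of_embedding
    (LeftOrderable.of_injective (MonoidHom.id (ℚ ≃o ℚ)) Function.injective_id) ψ hψ s hs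
    fun i => OrderIso.zpow_eq_one_iff fun h => hred i (hψ ?_)
  rw [← hs, h, one_pow, map_one]
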